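/- Let $N\ge 1$ and write points of $\mathbb{R}^{N+1}$ as $(z,t)$ with $z\in\mathbb{R}^N$, $t\in\mathbb{R}$. Set $$\rho(z,t)=(|z|^4+4t^2)^{1/4},\qquad \psi(z,t)=\frac{|z|^2}{\rho(z,t)^2},\qquad B_r=\{(z,t):\rho(z,t)<r\}.$$ Let $X_i=\partial_{z_i}$ and $Y_j=z_j\partial_t$ for $1\le i,j\le N$, and let $M^{2,2}(B_1)$ be the space of real-valued $u\in L^2(B_1)$ such that all the distributional derivatives $X_iu,\ Y_ju,\ X_iX_ju,\ X_iY_ju,\ Y_iX_ju,\ Y_iY_ju$ $(1\le i,j\le N)$ belong to $L^2(B_1)$. Then for every $u\in M^{2,2}(B_1)$ the following are equivalent: 1. $u$ vanishes to infinite order at $(0,0)$ in the $L^2$ mean, i.e. for every $l>0$, $\displaystyle\int_{B_r}|u|^2\,dz\,dt=O(r^l)$ as $r\to0^+$; 2. for every $l>0$, $\displaystyle\int_{B_r}u^2\,\psi\,dz\,dt=O(r^l)$ as $r\to0^+$. -/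

import Mathlib

open MeasureTheory Filter Topology Asymptotics
open scoped ContDiff

noncomputable section

/-- The space `ℝ^N × ℝ = ℝ^{N+1}` with points `p = (z, t)`; its `volume` is the product of the
Lebesgue measures, i.e. Lebesgue measure `dz dt`. -/
abbrev GrushinSpace (N : ℕ) : Type := EuclideanSpace ℝ (Fin N) × ℝ

/-- The non-isotropic gauge `ρ(z,t) = (|z|^4 + 4 t^2)^{1/4}`, with `|z|` the Euclidean norm. -/
def grushinGauge {N : ℕ} (p : GrushinSpace N) : ℝ :=
  (‖p.1‖ ^ 4 + 4 * p.2 ^ 2) ^ (1 / 4 : ℝ)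

/-- The degenerate weight `ψ(z,t) = |z|^2 / ρ(z,t)^2` (its value at the origin is immaterial). -/
def grushinWeight {N : ℕ} (p : GrushinSpace N) : ℝ :=
  ‖p.1‖ ^ 2 / grushinGauge p ^ 2

/-- The open gauge ball `B_r((0,t₀))`. -/
def gaugeBall (N : ℕ) (t₀ r : ℝ) : Set (GrushinSpace N) :=
  {p | grushinGauge (p.1, p.2 - t₀) < r}

/-- The vector fields `X_i = ∂_{z_i}` (index `Sum.inl i`) and `Y_j = z_j ∂_t` (index `Sum.inr j`),
given by their coefficient vectors at each point. -/
def grushinField {N : ℕ} : Fin N ⊕ Fin N → GrushinSpace N → GrushinSpace N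
  | Sum.inl i, _ => (EuclideanSpace.single i 1, 0)
  | Sum.inr j, p => (0, p.1 j)

/-- `Z_a u = v` on the open set `Ω` in the sense of distributions, where `Z_a` is one of the
fields `X_i`, `Y_j`. These fields are divergence free, so the formal adjoint of `Z_a` is `-Z_a`,
and the condition is `∫_Ω u (Z_a φ) = - ∫_Ω v φ` for all `φ ∈ C_c^∞(Ω)`. -/
def HasWeakFieldDeriv {N : ℕ} (Ω : Set (GrushinSpace N)) (a : Fin N ⊕ Fin N)
    (u v : GrushinSpace N → ℝ) : Prop :=
  LocallyIntegrableOn u Ω ∧ LocallyIntegrableOn v Ω ∧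
    ∀ φ : GrushinSpace N → ℝ, ContDiff ℝ ∞ φ → HasCompactSupport φ → tsupport φ ⊆ Ω →
      ∫ p in Ω, u p * fderiv ℝ φ p (grushinField a p) = -∫ p in Ω, v p * φ p

/-- `u ∈ M^{2,2}(Ω)`: `u`, all first order derivatives `Z_a u` and all second order derivatives
`Z_b Z_a u`, with `Z_a, Z_b` among the `X_i` and `Y_j`, are in `L^2(Ω)`. -/
def MemM22 {N : ℕ} (Ω : Set (GrushinSpace N)) (u : GrushinSpace N → ℝ) : Prop :=
  MemLp u 2 (volume.restrict Ω) ∧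
    ∀ a, ∃ v, MemLp v 2 (volume.restrict Ω) ∧ HasWeakFieldDeriv Ω a u v ∧
      ∀ b, ∃ w, MemLp w 2 (volume.restrict Ω) ∧ HasWeakFieldDeriv Ω b v w

/-- `u` vanishes to infinite order at `(0,t₀)` in the `L^q` mean:
`∫_{B_r(0,t₀)} |u|^q dz dt = O(r^l)` as `r → 0+`, for all `l > 0`; the integrals are required to
be genuine ones for small `r`. -/
def VanishesInfiniteOrderMean {N : ℕ} (q t₀ : ℝ) (u : GrushinSpace N → ℝ) : Prop :=
  (∃ R > 0, IntegrableOn (fun p => |u p| ^ q) (gaugeBall N t₀ R)) ∧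
    ∀ l : ℝ, 0 < l →
      (fun r : ℝ => ∫ p in gaugeBall N t₀ r, |u p| ^ q) =O[𝓝[>] 0] fun r : ℝ => r ^ l

/-- `u` vanishes to infinite order at `(0,0)` in the weighted sense:
`∫_{B_r} u^2 ψ dz dt = O(r^l)` as `r → 0+`, for all `l > 0`; the integrals are required to
be genuine ones for small `r`. -/
def VanishesInfiniteOrderWeighted {N : ℕ} (u : GrushinSpace N → ℝ) : Prop :=
  (∃ R > 0, IntegrableOn (fun p => u p ^ 2 * grushinWeight p) (gaugeBall N 0 R)) ∧
    ∀ l : ℝ, 0 < l →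
      (fun r : ℝ => ∫ p in gaugeBall N 0 r, u p ^ 2 * grushinWeight p) =O[𝓝[>] 0]
        fun r : ℝ => r ^ l

end

/-!
Since `0 ≤ ψ ≤ 1`, vanishing in the `L²` mean trivially gives weighted vanishing. The content is the
converse, where the weight `ψ = |z|² / ρ²` degenerates on the `t`-axis `{z = 0}`.

Split the gauge ball `B_r` at `|z| = δ`. Where `|z| > δ` the weight is at least `δ² / r²`, so that
part of `∫ u²` is at most `(r² / δ²) ∫_{B_r} u² ψ` (`sq_le_mul_grushinWeight`). The part where
`|z| ≤ δ` lies in a slab of width `2 δ` around `{z₁ = 0}`, and there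
`∫ u² = O(δ)` (`setIntegral_sq_degenerate_box_le`), because `u` and the single weak derivative
`X₁ u` are in `L²`. The choice `δ = r ^ l`, together with `∫_{B_r} u² ψ = O(r ^ (3 l))`, bounds both
parts by a multiple of `r ^ l`.

The slab estimate `setIntegral_sq_slab_le` expresses that an `H¹` function of one variable is
bounded. It is proved by duality, without choosing representatives of `u`. For a test function `φ`
supported in the slab `|ℓ x| ≤ δ`, where `ℓ e = 1`, the function
`Φ(x) = ∫₀ᴴ (1 - s / H) φ(x - s e) ds` is again a test function, and
`∂ₑ Φ = φ - H⁻¹ ∫₀ᴴ φ(x - s e) ds` (`fderiv_segmentIntegral_tent`). Testing the weak derivative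
against `Φ` thus expresses `∫ u φ` through pairings of `u` and `∂ₑ u` with two segment integrals
of `φ`. A segment meets the slab in length at most `2 δ`, so these have squared `L²` norm at most
`2 δ H ‖φ‖²` (`integral_sq_segmentIntegral_le`), whence `(∫ u φ)² ≤ C δ ‖φ‖²`. Approximating `u`
itself by test functions (`setIntegral_sq_le_of_forall_test`) gives `∫ u² ≤ C δ`.
-/

/-! ### Square-integrable functions and duality with test functions -/

theorem integral_mul_add_sq {α : Type*} [MeasurableSpace α] {μ : Measure α} {f g : α → ℝ}
    (hf : MemLp f 2 μ) (hg : MemLp g 2 μ) (c : ℝ) :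
    ∫ x, (c * f x + g x) ^ 2 ∂μ =
      c ^ 2 * ∫ x, f x ^ 2 ∂μ + 2 * c * ∫ x, f x * g x ∂μ + ∫ x, g x ^ 2 ∂μ := by
  have hfg : Integrable (fun x => f x * g x) μ := hf.integrable_mul hg
  have h1 : Integrable (fun x => c ^ 2 * f x ^ 2) μ := hf.integrable_sq.const_mul _
  have h2 : Integrable (fun x => 2 * c * (f x * g x)) μ := hfg.const_mul _
  have h3 : Integrable (fun x => c ^ 2 * f x ^ 2 + 2 * c * (f x * g x)) μ := h1.add h2
  rw [← integral_const_mul, ← integral_const_mul, ← integral_add h1 h2,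
    ← integral_add h3 hg.integrable_sq]
  congr 1
  ext x
  ring

theorem sq_integral_mul_le {α : Type*} [MeasurableSpace α] {μ : Measure α} {f g : α → ℝ}
    (hf : MemLp f 2 μ) (hg : MemLp g 2 μ) :
    (∫ x, f x * g x ∂μ) ^ 2 ≤ (∫ x, f x ^ 2 ∂μ) * ∫ x, g x ^ 2 ∂μ := by
  have key : ∀ c : ℝ, 0 ≤ (∫ x, f x ^ 2 ∂μ) * (c * c) + (2 * ∫ x, f x * g x ∂μ) * c
      + ∫ x, g x ^ 2 ∂μ := by
    intro c
    have h : 0 ≤ ∫ x, (c * f x + g x) ^ 2 ∂μ := integral_nonneg fun x => sq_nonneg _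
    rw [integral_mul_add_sq hf hg] at h
    linarith
  have h := discrim_le_zero key
  rw [discrim] at h
  linarith

theorem integral_sq_le_of_eLpNorm_le {α : Type*} [MeasurableSpace α] {μ : Measure α} {f : α → ℝ}
    (hf : MemLp f 2 μ) {ε : ℝ} (hε : 0 ≤ ε) (h : eLpNorm f 2 μ ≤ ENNReal.ofReal ε) :
    ∫ x, f x ^ 2 ∂μ ≤ ε ^ 2 := by
  rw [hf.eLpNorm_eq_integral_rpow_norm two_ne_zero ENNReal.ofNat_ne_top,
    ENNReal.ofReal_le_ofReal_iff hε] at h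
  have h0 : 0 ≤ ∫ x, f x ^ 2 ∂μ := integral_nonneg fun x => sq_nonneg _
  simp only [ENNReal.toReal_ofNat, Real.rpow_two, Real.norm_eq_abs, sq_abs] at h
  calc ∫ x, f x ^ 2 ∂μ = ((∫ x, f x ^ 2 ∂μ) ^ (2⁻¹ : ℝ)) ^ 2 := by
        rw [← Real.rpow_natCast, ← Real.rpow_mul h0]; norm_num
    _ ≤ ε ^ 2 := by gcongr

theorem exists_contDiff_cutoff {E : Type*} [NormedAddCommGroup E] [NormedSpace ℝ E]
    [FiniteDimensional ℝ E] {K O : Set E} (hK : IsCompact K) (hO : IsOpen O) (hKO : K ⊆ O) :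
    ∃ χ : E → ℝ, ContDiff ℝ ∞ χ ∧ tsupport χ ⊆ O ∧ (∀ x ∈ K, χ x = 1) ∧
      ∀ x, χ x ∈ Set.Icc (0 : ℝ) 1 := by
  obtain ⟨V, hV, hKV, hVO⟩ := normal_exists_closure_subset hK.isClosed hO hKO
  obtain ⟨χ, h0, h1, h01⟩ := exists_contMDiffMap_zero_one_of_isClosed (n := ⊤)
    (modelWithCornersSelf ℝ E) (s := Vᶜ) (t := K) hV.isClosed_compl hK.isClosed
    (Set.disjoint_compl_left_iff_subset.2 hKV)
  refine ⟨χ, χ.contMDiff.contDiff, (closure_mono fun x hx => ?_).trans hVO, h1, h01⟩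
  by_contra hxV
  exact hx (h0 hxV)

section Duality

variable {E : Type*} [NormedAddCommGroup E] [NormedSpace ℝ E] [FiniteDimensional ℝ E]
  [MeasurableSpace E] [BorelSpace E] {μ : Measure E} [IsFiniteMeasureOnCompacts μ]

/-- If the functional `φ ↦ ∫ u φ` has squared `L²` norm at most `A` on the test functions supported
in `O`, then `∫ u² ≤ A` on every compact subset of `O`. -/
theorem setIntegral_sq_le_of_forall_test {Ω O K : Set E} {u : E → ℝ} {A : ℝ} (hA : 0 ≤ A)
    (hu : MemLp u 2 (μ.restrict Ω)) (hO : IsOpen O) (hOΩ : O ⊆ Ω) (hK : IsCompact K) (hKO : K ⊆ O)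
    (h : ∀ φ : E → ℝ, ContDiff ℝ ∞ φ → HasCompactSupport φ → tsupport φ ⊆ O →
      (∫ x in Ω, u x * φ x ∂μ) ^ 2 ≤ A * ∫ x, φ x ^ 2 ∂μ) :
    ∫ x in K, u x ^ 2 ∂μ ≤ A := by
  classical
  obtain ⟨χ, hχ, hχO, hχ1, hχ01⟩ := exists_contDiff_cutoff hK hO hKO
  have hKm : MeasurableSet K := hK.measurableSet
  have hKΩ : K ⊆ Ω := hKO.trans hOΩ
  set f : E → ℝ := K.indicator u with hf_def
  have hf : MemLp f 2 μ :=
    (memLp_indicator_iff_restrict hKm).2 (hu.mono_measure (Measure.restrict_mono hKΩ le_rfl))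
  set I : ℝ := ∫ x in K, u x ^ 2 ∂μ with hI
  have hfI : ∫ x, f x ^ 2 ∂μ = I := by
    rw [hI, ← integral_indicator hKm]
    congr 1; ext x
    by_cases hx : x ∈ K <;> simp [hf_def, hx]
  have hufI : ∫ x in Ω, u x * f x ∂μ = I := by
    have : (fun x => u x * f x) = K.indicator fun x => u x ^ 2 := by
      ext x
      by_cases hx : x ∈ K <;> simp [hf_def, hx, sq]
    rw [this, setIntegral_indicator hKm, Set.inter_eq_right.2 hKΩ]
  -- Test functions supported in `O` that converge to `f` in `L²`: smooth approximations of `f`,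
  -- multiplied by the cutoff `χ`. As `χ f = f` and `|χ| ≤ 1`, the cutoff does not enlarge the error.
  have hex : ∀ n : ℕ, ∃ φ : E → ℝ, ContDiff ℝ ∞ φ ∧ HasCompactSupport φ ∧ tsupport φ ⊆ O ∧
      ∫ x, (f x - φ x) ^ 2 ∂μ ≤ (1 / ((n : ℝ) + 1)) ^ 2 := by
    intro n
    have hn : (0 : ℝ) < 1 / ((n : ℝ) + 1) := by positivity
    obtain ⟨g, hgc, hg, hfg⟩ := hf.exist_eLpNorm_sub_le ENNReal.ofNat_ne_top (by norm_num) hn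
    have hgL : MemLp g 2 μ := hg.continuous.memLp_of_hasCompactSupport hgc
    have hφc : HasCompactSupport fun x => χ x * g x := hgc.mul_left
    have hφL : MemLp (fun x => χ x * g x) 2 μ :=
      (hχ.mul hg).continuous.memLp_of_hasCompactSupport hφc
    refine ⟨fun x => χ x * g x, hχ.mul hg, hφc, (closure_mono fun x hx => ?_).trans hχO, ?_⟩
    · exact left_ne_zero_of_mul hx
    · refine integral_sq_le_of_eLpNorm_le (hf.sub hφL) hn.le ((eLpNorm_mono fun x => ?_).trans hfg)
      have : f x - χ x * g x = χ x * (f x - g x) := by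
        by_cases hx : x ∈ K
        · rw [hχ1 x hx]; ring
        · simp [hf_def, hx]
      simp only [Pi.sub_apply]
      rw [this, norm_mul, Real.norm_of_nonneg (hχ01 x).1]
      exact mul_le_of_le_one_left (norm_nonneg _) (hχ01 x).2
  choose φ hφ hφc hφO hφf using hex
  have hφL : ∀ n, MemLp (φ n) 2 μ := fun n =>
    (hφ n).continuous.memLp_of_hasCompactSupport (hφc n)
  have hdL : ∀ n, MemLp (fun x => f x - φ n x) 2 μ := fun n => hf.sub (hφL n)
  have hlim : Tendsto (fun n : ℕ => (1 / ((n : ℝ) + 1)) ^ 2) atTop (𝓝 0) := by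
    simpa using (tendsto_one_div_add_atTop_nhds_zero_nat (𝕜 := ℝ)).pow 2
  have hd : Tendsto (fun n => ∫ x, (f x - φ n x) ^ 2 ∂μ) atTop (𝓝 0) :=
    squeeze_zero (fun n => integral_nonneg fun x => sq_nonneg _) hφf hlim
  have aux : ∀ {a b : ℕ → ℝ} {c : ℝ}, (∀ n, a n ^ 2 ≤ c * b n) → Tendsto b atTop (𝓝 0) →
      Tendsto a atTop (𝓝 0) := by
    intro a b c hab hb
    have h1 : Tendsto (fun n => a n ^ 2) atTop (𝓝 0) :=
      squeeze_zero (fun n => sq_nonneg _) hab (by simpa using hb.const_mul c)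
    have h2 := h1.sqrt
    simp only [Real.sqrt_sq_eq_abs, Real.sqrt_zero] at h2
    exact (tendsto_zero_iff_abs_tendsto_zero _).2 h2
  have hp : Tendsto (fun n => ∫ x in Ω, u x * (f x - φ n x) ∂μ) atTop (𝓝 0) := by
    refine aux (c := ∫ x in Ω, u x ^ 2 ∂μ) (fun n => ?_) hd
    refine (sq_integral_mul_le hu ((hdL n).restrict Ω)).trans ?_
    refine mul_le_mul_of_nonneg_left ?_ (integral_nonneg fun x => sq_nonneg _)
    exact setIntegral_le_integral (hdL n).integrable_sq (ae_of_all _ fun x => sq_nonneg _)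
  have hq : Tendsto (fun n => ∫ x, (f x - φ n x) * f x ∂μ) atTop (𝓝 0) :=
    aux (fun n => (sq_integral_mul_le (hdL n) hf).trans_eq (mul_comm _ _)) hd
  -- The hypothesis for `φ n`, rewritten in terms of the error `f - φ n`.
  have hineq : ∀ n, (I - ∫ x in Ω, u x * (f x - φ n x) ∂μ) ^ 2 ≤
      A * (I - 2 * (∫ x, (f x - φ n x) * f x ∂μ) + ∫ x, (f x - φ n x) ^ 2 ∂μ) := by
    intro n
    have h1 : I - ∫ x in Ω, u x * (f x - φ n x) ∂μ = ∫ x in Ω, u x * φ n x ∂μ := by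
      have h3 : Integrable (fun x => u x * f x) (μ.restrict Ω) := hu.integrable_mul (hf.restrict Ω)
      have h4 : Integrable (fun x => u x * (f x - φ n x)) (μ.restrict Ω) :=
        hu.integrable_mul ((hdL n).restrict Ω)
      rw [← hufI, ← integral_sub h3 h4]
      congr 1; ext x; ring
    have h2 : I - 2 * (∫ x, (f x - φ n x) * f x ∂μ) + ∫ x, (f x - φ n x) ^ 2 ∂μ
        = ∫ x, φ n x ^ 2 ∂μ := by
      have h3 := integral_mul_add_sq (hdL n) hf (-1)
      rw [hfI] at h3
      have h4 : ∀ x, (-1 * (f x - φ n x) + f x) ^ 2 = φ n x ^ 2 := fun x => by ring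
      simp only [h4] at h3
      rw [h3]
      ring
    rw [h1, h2]
    exact h _ (hφ n) (hφc n) (hφO n)
  have hII : I ^ 2 ≤ A * I := by
    have := le_of_tendsto_of_tendsto' ((hp.const_sub I).pow 2)
      (((((hq.const_mul 2).const_sub I).add hd)).const_mul A) hineq
    simpa using this
  have hI0 : 0 ≤ I := integral_nonneg fun x => sq_nonneg _
  by_contra! hAI
  nlinarith

end Duality

/-! ### Integrals along segments -/

/-- The weighted integral `∫₀ᴴ w(s) φ(x - s e) ds` of `φ` along the segment from `x` in the
direction `-e`. -/
noncomputable def segmentIntegral {E : Type*} [AddCommGroup E] [Module ℝ E] (w : ℝ → ℝ) (H : ℝ)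
    (e : E) (φ : E → ℝ) (x : E) : ℝ :=
  ∫ s in Set.Ioc 0 H, w s * φ (x - s • e)

section SegmentIntegral

variable {E : Type*} [NormedAddCommGroup E] [NormedSpace ℝ E]
  {w : ℝ → ℝ} {H : ℝ} {e : E} {φ : E → ℝ} {ℓ : E →L[ℝ] ℝ}

/-- The segment integral is the convolution of `φ` with the measure `w(s) ds` carried by the segment
`[0, H] e`; the functional `ℓ` recovers the parameter `s` from the point `s e`. -/
theorem contDiff_segmentIntegral [MeasurableSpace E] [BorelSpace E] (hw : Continuous w)
    (hℓ : ℓ e = 1) (hφ : ContDiff ℝ ∞ φ) (hφc : HasCompactSupport φ) :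
    ContDiff ℝ ∞ (segmentIntegral w H e φ) := by
  have hm : Continuous fun s : ℝ => s • e := by fun_prop
  set ν : Measure E := (volume.restrict (Set.Ioc 0 H)).map fun s : ℝ => s • e with hν
  have hwl : LocallyIntegrable (fun p => w (ℓ p)) ν :=
    Continuous.locallyIntegrable (by fun_prop)
  have h := hφc.contDiff_convolution_right (n := ⊤) (ContinuousLinearMap.mul ℝ ℝ) hwl hφ
  convert h using 1
  ext x
  rw [convolution_def, hν, integral_map hm.aemeasurable]
  · simp [segmentIntegral, hℓ]
  · have := hφ.continuous
    exact Continuous.aestronglyMeasurable (by simp only [ContinuousLinearMap.mul_apply']; fun_prop)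

theorem tsupport_segmentIntegral_subset {K K' : Set E} (hφK : Function.support φ ⊆ K)
    (hK' : IsClosed K') (hKK' : ∀ x ∈ K, ∀ s ∈ Set.Ioc 0 H, x + s • e ∈ K') :
    tsupport (segmentIntegral w H e φ) ⊆ K' := by
  refine closure_minimal (fun x hx => ?_) hK'
  by_contra hxK
  refine hx (setIntegral_eq_zero_of_forall_eq_zero fun s hs => ?_)
  suffices φ (x - s • e) = 0 by rw [this, mul_zero]
  by_contra h0
  exact hxK (by simpa using hKK' _ (hφK h0) s hs)

/-- Cauchy–Schwarz on the segment: only the parameters `s` with `|ℓ x - s| ≤ δ`, an interval of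
length `2 δ`, contribute to the segment integral. -/
theorem sq_segmentIntegral_le {δ : ℝ} (hδ : 0 ≤ δ) (hw : Continuous w)
    (hw1 : ∀ s ∈ Set.Ioc 0 H, |w s| ≤ 1) (hℓ : ℓ e = 1) (hφ : Continuous φ)
    (hφδ : ∀ x, φ x ≠ 0 → |ℓ x| ≤ δ) (x : E) :
    segmentIntegral w H e φ x ^ 2 ≤ 2 * δ * ∫ s in Set.Ioc 0 H, φ (x - s • e) ^ 2 := by
  classical
  set J : Set ℝ := Set.Icc (ℓ x - δ) (ℓ x + δ) with hJ
  have hJm : MeasurableSet J := measurableSet_Icc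
  have hbd : ∀ g : ℝ → ℝ, Continuous g → MemLp g 2 (volume.restrict (Set.Ioc 0 H)) := by
    intro g hg
    rw [memLp_two_iff_integrable_sq hg.aestronglyMeasurable]
    exact ((hg.pow 2).integrableOn_Icc).mono_set Set.Ioc_subset_Icc_self
  have h1 : segmentIntegral w H e φ x = ∫ s in Set.Ioc 0 H, J.indicator w s * φ (x - s • e) := by
    refine setIntegral_congr_fun measurableSet_Ioc fun s _ => ?_
    by_cases hs : s ∈ J
    · simp [hs]
    · have h0 : φ (x - s • e) = 0 := by
        by_contra h0
        have := hφδ _ h0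
        rw [map_sub, map_smul, hℓ, smul_eq_mul, mul_one, abs_le] at this
        exact hs ⟨by linarith, by linarith⟩
      simp [h0]
  have h2 : ∫ s in Set.Ioc 0 H, J.indicator w s ^ 2 ≤ 2 * δ := by
    calc ∫ s in Set.Ioc 0 H, J.indicator w s ^ 2
        ≤ ∫ s in Set.Ioc 0 H, J.indicator (fun _ => (1 : ℝ)) s := by
          refine setIntegral_mono_on ((hbd w hw).indicator hJm).integrable_sq
            ((integrable_const 1).indicator hJm) measurableSet_Ioc fun s hs => ?_
          by_cases hsJ : s ∈ J
          · simpa [hsJ] using hw1 s hs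
          · simp [hsJ]
      _ ≤ ∫ s, J.indicator (fun _ => (1 : ℝ)) s := by
          refine setIntegral_le_integral ?_ (ae_of_all _ fun s => Set.indicator_nonneg (by simp) s)
          rw [integrable_indicator_iff hJm]
          exact continuous_const.integrableOn_Icc
      _ = 2 * δ := by
          rw [integral_indicator hJm, setIntegral_const, hJ, Real.volume_real_Icc_of_le (by linarith)]
          simp; ring
  rw [h1]
  refine (sq_integral_mul_le ((hbd w hw).indicator hJm) (hbd _ (by fun_prop))).trans ?_
  exact mul_le_mul_of_nonneg_right h2 (integral_nonneg fun s => sq_nonneg _)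

theorem integral_sq_segmentIntegral_le [FiniteDimensional ℝ E] [MeasurableSpace E] [BorelSpace E]
    {μ : Measure E} [μ.IsAddHaarMeasure] {δ : ℝ} (hδ : 0 ≤ δ) (hH : 0 ≤ H) (hw : Continuous w)
    (hw1 : ∀ s ∈ Set.Ioc 0 H, |w s| ≤ 1) (hℓ : ℓ e = 1) (hφ : Continuous φ)
    (hφc : HasCompactSupport φ) (hφδ : ∀ x, φ x ≠ 0 → |ℓ x| ≤ δ) :
    ∫ x, segmentIntegral w H e φ x ^ 2 ∂μ ≤ 2 * δ * H * ∫ x, φ x ^ 2 ∂μ := by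
  have hφi : Integrable (fun x => φ x ^ 2) μ := (hφ.memLp_of_hasCompactSupport hφc).integrable_sq
  have hint : Integrable (Function.uncurry fun (x : E) (s : ℝ) => φ (x - s • e) ^ 2)
      (μ.prod (volume.restrict (Set.Ioc 0 H))) := by
    rw [integrable_prod_iff' (Continuous.aestronglyMeasurable (by
      simp only [Function.uncurry_def]; fun_prop))]
    refine ⟨ae_of_all _ fun s => hφi.comp_sub_right (s • e), ?_⟩
    simp only [Function.uncurry_apply_pair]
    simp_rw [fun s : ℝ => integral_sub_right_eq_self (μ := μ) (fun x => ‖φ x ^ 2‖) (s • e)]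
    exact integrable_const _
  calc ∫ x, segmentIntegral w H e φ x ^ 2 ∂μ
      ≤ ∫ x, 2 * δ * (∫ s in Set.Ioc 0 H, φ (x - s • e) ^ 2) ∂μ :=
        integral_mono_of_nonneg (ae_of_all _ fun x => sq_nonneg _)
          (hint.integral_prod_left.const_mul _)
          (ae_of_all _ fun x => sq_segmentIntegral_le hδ hw hw1 hℓ hφ hφδ x)
    _ = 2 * δ * ∫ s in Set.Ioc 0 H, ∫ x, φ (x - s • e) ^ 2 ∂μ := by
        rw [integral_const_mul, integral_integral_swap hint]
    _ = 2 * δ * H * ∫ x, φ x ^ 2 ∂μ := by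
        simp_rw [fun s : ℝ => integral_sub_right_eq_self (μ := μ) (fun x => φ x ^ 2) (s • e)]
        rw [setIntegral_const, Real.volume_real_Ioc_of_le hH]
        simp; ring

theorem hasDerivAt_segmentIntegral (hw : Continuous w) (hφ : ContDiff ℝ 1 φ)
    (hφc : HasCompactSupport φ) (x : E) :
    HasDerivAt (fun τ : ℝ => segmentIntegral w H e φ (x + τ • e))
      (segmentIntegral w H e (fun y => fderiv ℝ φ y e) x) 0 := by
  have hφ' : Continuous fun y => fderiv ℝ φ y e :=
    (hφ.continuous_fderiv one_ne_zero).clm_apply continuous_const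
  obtain ⟨C, hC⟩ := (hφc.fderiv_apply (𝕜 := ℝ) e).exists_bound_of_continuous hφ'
  have hφ0 := hφ.continuous
  have h := hasDerivAt_integral_of_dominated_loc_of_deriv_le (𝕜 := ℝ)
    (μ := volume.restrict (Set.Ioc 0 H)) (x₀ := (0 : ℝ)) (s := Set.univ)
    (F := fun τ s => w s * φ (x + τ • e - s • e))
    (F' := fun τ s => w s * fderiv ℝ φ (x + τ • e - s • e) e)
    (bound := fun s => |w s| * C) univ_mem
    (Eventually.of_forall fun τ => Continuous.aestronglyMeasurable (by fun_prop))
    ((Continuous.integrableOn_Icc (by fun_prop)).mono_set Set.Ioc_subset_Icc_self)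
    (Continuous.aestronglyMeasurable (by fun_prop))
    (ae_of_all _ fun s τ _ => by
      rw [norm_mul]; exact mul_le_mul_of_nonneg_left (hC _) (norm_nonneg _))
    ((Continuous.integrableOn_Icc (by fun_prop)).mono_set Set.Ioc_subset_Icc_self)
    (ae_of_all _ fun s τ _ => by
      have h1 : HasDerivAt (fun τ : ℝ => x + τ • e - s • e) e τ := by
        simpa using (((hasDerivAt_id τ).smul_const e).const_add x).sub_const (s • e)
      exact (((hφ.differentiable one_ne_zero _).hasFDerivAt.comp_hasDerivAt τ h1).const_mul _))
  simpa [segmentIntegral] using h.2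

/-- Integration by parts along the segment: the derivative of the tent-weighted segment integral
in the direction `e` is `φ` minus the average of `φ` over the segment. -/
theorem fderiv_segmentIntegral_tent [MeasurableSpace E] [BorelSpace E] (hH : 0 < H)
    (hℓ : ℓ e = 1) (hφ : ContDiff ℝ ∞ φ) (hφc : HasCompactSupport φ) (x : E) :
    fderiv ℝ (segmentIntegral (fun s => 1 - s / H) H e φ) x e =
      φ x - H⁻¹ * segmentIntegral (fun _ => 1) H e φ x := by
  have hw : Continuous fun s : ℝ => 1 - s / H := by fun_prop
  have hφ1 : ContDiff ℝ 1 φ := hφ.of_le (by simp)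
  have hφ' : Continuous fun y => fderiv ℝ φ y e :=
    (hφ1.continuous_fderiv one_ne_zero).clm_apply continuous_const
  have hd : Differentiable ℝ (segmentIntegral (fun s => 1 - s / H) H e φ) :=
    (contDiff_segmentIntegral hw hℓ hφ hφc).differentiable (by simp)
  have h1 : HasDerivAt (fun τ : ℝ => x + τ • e) e 0 := by
    simpa using ((hasDerivAt_id (0 : ℝ)).smul_const e).const_add x
  have h2 := (hd (x + (0 : ℝ) • e)).hasFDerivAt.comp_hasDerivAt 0 h1
  rw [zero_smul, add_zero] at h2
  rw [h2.unique (hasDerivAt_segmentIntegral hw hφ1 hφc x)]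
  have hv : ∀ s : ℝ, HasDerivAt (fun s : ℝ => -φ (x - s • e)) (fderiv ℝ φ (x - s • e) e) s := by
    intro s
    have h3 : HasDerivAt (fun s : ℝ => x - s • e) (-e) s := by
      simpa using ((hasDerivAt_id s).smul_const e).const_sub x
    have h4 := ((hφ1.differentiable one_ne_zero _).hasFDerivAt.comp_hasDerivAt s h3).neg
    rwa [map_neg, neg_neg] at h4
  have hu : ∀ s : ℝ, HasDerivAt (fun s : ℝ => 1 - s / H) (-H⁻¹) s := by
    intro s
    simpa using ((hasDerivAt_id s).div_const H).const_sub 1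
  have h4 := intervalIntegral.integral_mul_deriv_eq_deriv_mul (a := 0) (b := H)
    (fun s _ => hu s) (fun s _ => hv s) (continuous_const.intervalIntegrable _ _)
    (Continuous.intervalIntegrable (by fun_prop) _ _)
  rw [intervalIntegral.integral_of_le hH.le, intervalIntegral.integral_of_le hH.le] at h4
  simp only [segmentIntegral]
  rw [h4, ← integral_const_mul]
  simp [hH.ne']

end SegmentIntegral

/-! ### Weakly differentiable functions on thin slabs -/

section Slab

variable {E : Type*} [NormedAddCommGroup E] [NormedSpace ℝ E] [FiniteDimensional ℝ E]
  [MeasurableSpace E] [BorelSpace E] {μ : Measure E} [μ.IsAddHaarMeasure]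
  {H δ : ℝ} {e : E} {ℓ : E →L[ℝ] ℝ} {Ω K : Set E} {u v : E → ℝ}

/-- Suppose `v` is the weak derivative of `u` in the direction `e` on `Ω`. Pairing `u` with a test
function supported in the slab `|ℓ x| ≤ δ` gains a factor `δ`, provided that the segments of
length `H` in the direction `e` that start on the support stay in `Ω`. -/
theorem sq_integral_mul_le_of_support_subset_slab (hu : MemLp u 2 (μ.restrict Ω))
    (hv : MemLp v 2 (μ.restrict Ω))
    (huv : ∀ φ : E → ℝ, ContDiff ℝ ∞ φ → HasCompactSupport φ → tsupport φ ⊆ Ω →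
      ∫ x in Ω, u x * fderiv ℝ φ x e ∂μ = -∫ x in Ω, v x * φ x ∂μ)
    (hH : 0 < H) (hδ : 0 ≤ δ) (hℓ : ℓ e = 1) (hK : IsCompact K)
    (hKΩ : ∀ x ∈ K, ∀ s ∈ Set.Icc 0 H, x + s • e ∈ Ω)
    {φ : E → ℝ} (hφ : ContDiff ℝ ∞ φ) (hφc : HasCompactSupport φ)
    (hφK : ∀ x, φ x ≠ 0 → x ∈ K ∧ |ℓ x| ≤ δ) :
    (∫ x in Ω, u x * φ x ∂μ) ^ 2 ≤
      δ * (4 / H * (∫ x in Ω, u x ^ 2 ∂μ) + 4 * H * ∫ x in Ω, v x ^ 2 ∂μ) *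
        ∫ x, φ x ^ 2 ∂μ := by
  set F : ℝ := ∫ x, φ x ^ 2 ∂μ
  set K' : Set E := (fun p : E × ℝ => p.1 + p.2 • e) '' (K ×ˢ Set.Icc 0 H) with hK'
  have hK'c : IsCompact K' := (hK.prod isCompact_Icc).image (by fun_prop)
  have hK'Ω : K' ⊆ Ω := by
    rintro _ ⟨⟨x, s⟩, ⟨hx, hs⟩, rfl⟩
    exact hKΩ x hx s hs
  have hsupp : ∀ w : ℝ → ℝ, tsupport (segmentIntegral w H e φ) ⊆ K' := fun w =>
    tsupport_segmentIntegral_subset (fun x hx => (hφK x hx).1) hK'c.isClosed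
      fun x hx s hs => ⟨(x, s), ⟨hx, Set.Ioc_subset_Icc_self hs⟩, rfl⟩
  have hcomp : ∀ w : ℝ → ℝ, HasCompactSupport (segmentIntegral w H e φ) := fun w =>
    hK'c.of_isClosed_subset (isClosed_tsupport _) (hsupp w)
  -- Both the tent weight and the constant weight are bounded by `1`, so one estimate serves both.
  have hest : ∀ (w : ℝ → ℝ) (g : E → ℝ), Continuous w → (∀ s ∈ Set.Ioc 0 H, |w s| ≤ 1) →
      MemLp g 2 (μ.restrict Ω) → (∫ x in Ω, g x * segmentIntegral w H e φ x ∂μ) ^ 2 ≤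
        (∫ x in Ω, g x ^ 2 ∂μ) * (2 * δ * H * F) := by
    intro w g hw hw1 hg
    have hL : MemLp (segmentIntegral w H e φ) 2 μ :=
      (contDiff_segmentIntegral hw hℓ hφ hφc).continuous.memLp_of_hasCompactSupport (hcomp w)
    refine (sq_integral_mul_le hg (hL.restrict Ω)).trans ?_
    refine mul_le_mul_of_nonneg_left ?_ (integral_nonneg fun x => sq_nonneg _)
    exact (setIntegral_le_integral hL.integrable_sq (ae_of_all _ fun x => sq_nonneg _)).trans
      (integral_sq_segmentIntegral_le hδ hH.le hw hw1 hℓ hφ.continuous hφc fun x hx => (hφK x hx).2)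
  have hw : Continuous fun s : ℝ => 1 - s / H := by fun_prop
  have hΦ := contDiff_segmentIntegral (H := H) hw hℓ hφ hφc
  have hA := contDiff_segmentIntegral (continuous_const (y := (1 : ℝ))) hℓ hφ hφc (H := H)
  have h1 := hest (fun s => 1 - s / H) v hw (fun s hs => by
    have h0 : 0 ≤ s / H := div_nonneg hs.1.le hH.le
    have h2 : s / H ≤ 1 := (div_le_one hH).2 hs.2
    rw [abs_le]; constructor <;> linarith) hv
  have h2 := hest (fun _ => 1) u continuous_const (by simp) hu
  have hAL := (hA.continuous.memLp_of_hasCompactSupport (hcomp _) (μ := μ) (p := 2)).restrict Ω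
  have hA' : Integrable (fun x => u x * segmentIntegral (fun _ => 1) H e φ x) (μ.restrict Ω) :=
    hu.integrable_mul hAL
  have hφL : Integrable (fun x => u x * φ x) (μ.restrict Ω) :=
    hu.integrable_mul
      ((hφ.continuous.memLp_of_hasCompactSupport hφc (μ := μ) (p := 2)).restrict Ω)
  have h3 : ∫ x in Ω, u x * φ x ∂μ =
      H⁻¹ * (∫ x in Ω, u x * segmentIntegral (fun _ => 1) H e φ x ∂μ) -
        ∫ x in Ω, v x * segmentIntegral (fun s => 1 - s / H) H e φ x ∂μ := by
    have h4 := huv _ hΦ (hcomp _) ((hsupp _).trans hK'Ω)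
    have h5 : ∀ x, u x * fderiv ℝ (segmentIntegral (fun s => 1 - s / H) H e φ) x e =
        u x * φ x - H⁻¹ * (u x * segmentIntegral (fun _ => 1) H e φ x) := fun x => by
      rw [fderiv_segmentIntegral_tent hH hℓ hφ hφc]; ring
    simp only [h5] at h4
    rw [integral_sub hφL (hA'.const_mul _), integral_const_mul] at h4
    linarith
  rw [h3]
  set p := ∫ x in Ω, v x * segmentIntegral (fun s => 1 - s / H) H e φ x ∂μ
  set q := ∫ x in Ω, u x * segmentIntegral (fun _ => 1) H e φ x ∂μ
  set U := ∫ x in Ω, u x ^ 2 ∂μ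
  set V := ∫ x in Ω, v x ^ 2 ∂μ
  calc (H⁻¹ * q - p) ^ 2 ≤ 2 * (H⁻¹ ^ 2 * q ^ 2) + 2 * p ^ 2 := by
        nlinarith [sq_nonneg (H⁻¹ * q + p)]
    _ ≤ 2 * (H⁻¹ ^ 2 * (U * (2 * δ * H * F))) + 2 * (V * (2 * δ * H * F)) := by gcongr
    _ = δ * (4 / H * U + 4 * H * V) * F := by field_simp; ring

/-- The `L²` mass of a weakly differentiable function in a slab of half-width `δ` transversal to the
direction of differentiation is `O(δ)`. -/
theorem setIntegral_sq_slab_le (hu : MemLp u 2 (μ.restrict Ω)) (hv : MemLp v 2 (μ.restrict Ω))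
    (huv : ∀ φ : E → ℝ, ContDiff ℝ ∞ φ → HasCompactSupport φ → tsupport φ ⊆ Ω →
      ∫ x in Ω, u x * fderiv ℝ φ x e ∂μ = -∫ x in Ω, v x * φ x ∂μ)
    (hH : 0 < H) (hδ : 0 ≤ δ) (hℓ : ℓ e = 1) (hK : IsCompact K)
    (hKΩ : ∀ x ∈ K, ∀ s ∈ Set.Icc 0 H, x + s • e ∈ Ω)
    {O C : Set E} (hO : IsOpen O) (hOK : ∀ x ∈ O, x ∈ K ∧ |ℓ x| ≤ δ) (hC : IsCompact C)
    (hCO : C ⊆ O) :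
    ∫ x in C, u x ^ 2 ∂μ ≤
      δ * (4 / H * (∫ x in Ω, u x ^ 2 ∂μ) + 4 * H * ∫ x in Ω, v x ^ 2 ∂μ) := by
  have hU : 0 ≤ ∫ x in Ω, u x ^ 2 ∂μ := integral_nonneg fun x => sq_nonneg _
  have hV : 0 ≤ ∫ x in Ω, v x ^ 2 ∂μ := integral_nonneg fun x => sq_nonneg _
  refine setIntegral_sq_le_of_forall_test (by positivity) hu hO (fun x hx => ?_) hC hCO
    fun φ hφ hφc hφO => ?_
  · simpa using hKΩ x (hOK x hx).1 0 ⟨le_rfl, hH.le⟩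
  · exact sq_integral_mul_le_of_support_subset_slab hu hv huv hH hδ hℓ hK hKΩ hφ hφc
      fun x hx => hOK x (hφO (subset_tsupport _ hx))

end Slab

/-! ### The gauge, the weight and the degenerate set `z = 0` -/

section Grushin

variable {N : ℕ}

theorem grushinGauge_nonneg (p : GrushinSpace N) : 0 ≤ grushinGauge p := by
  unfold grushinGauge; positivity

theorem grushinGauge_pow_four (p : GrushinSpace N) :
    grushinGauge p ^ 4 = ‖p.1‖ ^ 4 + 4 * p.2 ^ 2 := by
  rw [grushinGauge, ← Real.rpow_natCast, ← Real.rpow_mul (by positivity)]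
  norm_num

theorem continuous_grushinGauge : Continuous (grushinGauge (N := N)) := by
  unfold grushinGauge
  exact Continuous.rpow_const (by fun_prop) fun _ => Or.inr (by norm_num)

theorem mem_gaugeBall_zero_iff {r : ℝ} {p : GrushinSpace N} :
    p ∈ gaugeBall N 0 r ↔ grushinGauge p < r := by
  simp [gaugeBall]

theorem isOpen_gaugeBall_zero (r : ℝ) : IsOpen (gaugeBall N 0 r) := by
  have : gaugeBall N 0 r = grushinGauge ⁻¹' Set.Iio r := Set.ext fun p => mem_gaugeBall_zero_iff
  rw [this]
  exact isOpen_Iio.preimage continuous_grushinGauge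

theorem gaugeBall_zero_mono {r s : ℝ} (h : r ≤ s) : gaugeBall N 0 r ⊆ gaugeBall N 0 s := fun _ hp =>
  mem_gaugeBall_zero_iff.2 ((mem_gaugeBall_zero_iff.1 hp).trans_le h)

theorem norm_fst_sq_le_grushinGauge_sq (p : GrushinSpace N) : ‖p.1‖ ^ 2 ≤ grushinGauge p ^ 2 := by
  refine le_of_sq_le_sq ?_ (by positivity)
  have := grushinGauge_pow_four p
  nlinarith [sq_nonneg p.2]

theorem grushinWeight_nonneg (p : GrushinSpace N) : 0 ≤ grushinWeight p := by
  unfold grushinWeight; positivity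

theorem grushinWeight_le_one (p : GrushinSpace N) : grushinWeight p ≤ 1 :=
  div_le_one_of_le₀ (norm_fst_sq_le_grushinGauge_sq p) (sq_nonneg _)

theorem measurable_grushinWeight : Measurable (grushinWeight (N := N)) := by
  unfold grushinWeight
  have := (continuous_grushinGauge (N := N)).measurable
  fun_prop

theorem sq_le_mul_grushinWeight {r δ : ℝ} (hδ : 0 < δ) {p : GrushinSpace N}
    (hp : p ∈ gaugeBall N 0 r) (hpδ : δ < ‖p.1‖) (a : ℝ) :
    a ^ 2 ≤ r ^ 2 / δ ^ 2 * (a ^ 2 * grushinWeight p) := by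
  have h0 : 0 < ‖p.1‖ := hδ.trans hpδ
  have h1 : 0 < grushinGauge p ^ 2 := (by positivity : 0 < ‖p.1‖ ^ 2).trans_le
    (norm_fst_sq_le_grushinGauge_sq p)
  have h2 : grushinGauge p ^ 2 ≤ r ^ 2 := by
    gcongr
    · exact grushinGauge_nonneg p
    · exact (mem_gaugeBall_zero_iff.1 hp).le
  have h3 : 1 ≤ r ^ 2 / δ ^ 2 * grushinWeight p := by
    rw [grushinWeight, div_mul_div_comm, one_le_div (by positivity), mul_comm]
    gcongr
  calc a ^ 2 = a ^ 2 * 1 := (mul_one _).symm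
    _ ≤ a ^ 2 * (r ^ 2 / δ ^ 2 * grushinWeight p) := by gcongr
    _ = _ := by ring

theorem MemM22.integrableOn_sq {Ω : Set (GrushinSpace N)} {u : GrushinSpace N → ℝ}
    (hu : MemM22 Ω u) : IntegrableOn (fun p => u p ^ 2) Ω := hu.1.integrable_sq

theorem MemM22.integrableOn_sq_mul_grushinWeight {Ω : Set (GrushinSpace N)}
    {u : GrushinSpace N → ℝ} (hu : MemM22 Ω u) :
    IntegrableOn (fun p => u p ^ 2 * grushinWeight p) Ω := by
  refine Integrable.mono hu.integrableOn_sq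
    (hu.integrableOn_sq.aestronglyMeasurable.mul measurable_grushinWeight.aestronglyMeasurable)
    (ae_of_all _ fun p => ?_)
  rw [norm_mul, Real.norm_of_nonneg (grushinWeight_nonneg p)]
  exact mul_le_of_le_one_right (norm_nonneg _) (grushinWeight_le_one p)

/-- The slab estimate in the direction `X₁`: near the degenerate set `z = 0` the `L²` mass of `u` in
`|z| ≤ δ` is at most linear in `δ`. -/
theorem setIntegral_sq_degenerate_box_le (hN : 1 ≤ N) {u : GrushinSpace N → ℝ}
    (hu : MemM22 (gaugeBall N 0 1) u) :
    ∃ A : ℝ, ∀ δ : ℝ, 0 < δ → δ ≤ 1 / 8 →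
      ∫ p in Metric.closedBall (0 : EuclideanSpace ℝ (Fin N)) δ ×ˢ Set.Icc (-(1 / 8) : ℝ) (1 / 8),
        u p ^ 2 ≤ A * δ := by
  have : (volume : Measure (GrushinSpace N)).IsAddHaarMeasure :=
    inferInstanceAs (Measure.prod volume volume).IsAddHaarMeasure
  set i : Fin N := ⟨0, hN⟩
  obtain ⟨v, hv, huv, -⟩ := hu.2 (Sum.inl i)
  refine ⟨2 * (4 / (1 / 4) * (∫ p in gaugeBall N 0 1, u p ^ 2) +
    4 * (1 / 4) * ∫ p in gaugeBall N 0 1, v p ^ 2), fun δ hδ hδ8 => ?_⟩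
  -- Points with `|z| ≤ 1/4`, `|t| ≤ 1/4` moved by at most `1/4` in the direction `z₁` satisfy
  -- `|z|⁴ + 4 t² ≤ 1/16 + 1/4 < 1`, so they stay in the unit gauge ball.
  have h := setIntegral_sq_slab_le (H := 1 / 4) (δ := 2 * δ)
    (ℓ := (EuclideanSpace.proj i).comp (ContinuousLinearMap.fst ℝ (EuclideanSpace ℝ (Fin N)) ℝ))
    (e := (EuclideanSpace.single i 1, 0))
    (K := Metric.closedBall (0 : EuclideanSpace ℝ (Fin N)) (1 / 4) ×ˢ
      Set.Icc (-(1 / 4) : ℝ) (1 / 4))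
    (O := Metric.ball (0 : EuclideanSpace ℝ (Fin N)) (2 * δ) ×ˢ Set.Ioo (-(1 / 4) : ℝ) (1 / 4))
    (C := Metric.closedBall (0 : EuclideanSpace ℝ (Fin N)) δ ×ˢ Set.Icc (-(1 / 8) : ℝ) (1 / 8))
    hu.1 hv huv.2.2 (by norm_num) (by positivity) (by simp)
    ((isCompact_closedBall _ _).prod isCompact_Icc) ?_ (Metric.isOpen_ball.prod isOpen_Ioo) ?_
    ((isCompact_closedBall _ _).prod isCompact_Icc) ?_
  · exact h.trans_eq (by ring)
  · rintro ⟨z, t⟩ ⟨hz, ht⟩ s ⟨hs0, hs⟩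
    rw [mem_closedBall_zero_iff] at hz
    have h1 : ‖z + s • EuclideanSpace.single i (1 : ℝ)‖ ≤ 1 / 2 := by
      calc _ ≤ ‖z‖ + ‖s • EuclideanSpace.single i (1 : ℝ)‖ := norm_add_le _ _
        _ ≤ 1 / 4 + 1 / 4 := by
          gcongr
          rw [norm_smul, PiLp.norm_single, norm_one, mul_one, Real.norm_of_nonneg hs0]
          exact hs
        _ = 1 / 2 := by norm_num
    have h2 : t ^ 2 ≤ (1 / 4) ^ 2 := sq_le_sq' ht.1 ht.2
    rw [mem_gaugeBall_zero_iff]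
    refine lt_of_pow_lt_pow_left₀ 4 zero_le_one ?_
    rw [grushinGauge_pow_four]
    have h3 : ‖z + s • EuclideanSpace.single i (1 : ℝ)‖ ^ 4 ≤ (1 / 2) ^ 4 := by gcongr
    simp only [Prod.smul_mk, Prod.mk_add_mk, smul_zero, add_zero]
    linarith
  · rintro ⟨z, t⟩ ⟨hz, ht⟩
    rw [mem_ball_zero_iff] at hz
    refine ⟨⟨?_, ht.1.le, ht.2.le⟩, ?_⟩
    · rw [mem_closedBall_zero_iff]; linarith
    · simpa using (PiLp.norm_apply_le z i).trans hz.le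
  · refine Set.prod_mono (Metric.closedBall_subset_ball (by linarith)) fun t ht => ?_
    exact ⟨by linarith [ht.1], by linarith [ht.2]⟩

/-- The splitting of `B_r` at `|z| = δ`, with the part `|z| ≤ δ` enlarged to a box. -/
theorem setIntegral_sq_gaugeBall_le {u : GrushinSpace N → ℝ} (hu : MemM22 (gaugeBall N 0 1) u)
    {r δ : ℝ} (hr0 : 0 < r) (hr : r ≤ 1 / 4) (hδ : 0 < δ)
    (hδ8 : δ ≤ 1 / 8) :
    ∫ p in gaugeBall N 0 r, u p ^ 2 ≤
      (∫ p in Metric.closedBall (0 : EuclideanSpace ℝ (Fin N)) δ ×ˢ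
        Set.Icc (-(1 / 8) : ℝ) (1 / 8), u p ^ 2) +
      r ^ 2 / δ ^ 2 * ∫ p in gaugeBall N 0 r, u p ^ 2 * grushinWeight p := by
  set B := gaugeBall N 0 r
  set S : Set (GrushinSpace N) := {p | ‖p.1‖ ≤ δ}
  have hSm : MeasurableSet S := (isClosed_le (by fun_prop) continuous_const).measurableSet
  have hB1 : B ⊆ gaugeBall N 0 1 := gaugeBall_zero_mono (by linarith)
  have hBm : MeasurableSet B := (isOpen_gaugeBall_zero r).measurableSet
  have hui := hu.integrableOn_sq.mono_set hB1
  have hwi := hu.integrableOn_sq_mul_grushinWeight.mono_set hB1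
  rw [← integral_inter_add_sdiff hSm hui]
  refine add_le_add ?_ ?_
  · have hbox : Metric.closedBall (0 : EuclideanSpace ℝ (Fin N)) δ ×ˢ
        Set.Icc (-(1 / 8) : ℝ) (1 / 8) ⊇ B ∩ S := by
      rintro ⟨z, t⟩ ⟨hB, hS⟩
      refine ⟨mem_closedBall_zero_iff.2 hS, ?_⟩
      have h1 : grushinGauge (z, t) ^ 4 ≤ (1 / 4) ^ 4 := by
        gcongr
        · exact grushinGauge_nonneg _
        · exact (mem_gaugeBall_zero_iff.1 hB).le.trans hr
      rw [grushinGauge_pow_four] at h1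
      have h2 : 0 ≤ ‖z‖ ^ 4 := by positivity
      simp only at h1
      exact abs_le.1 (abs_le_of_sq_le_sq (by linarith) (by norm_num))
    have hbox1 : Metric.closedBall (0 : EuclideanSpace ℝ (Fin N)) δ ×ˢ
        Set.Icc (-(1 / 8) : ℝ) (1 / 8) ⊆ gaugeBall N 0 1 := by
      rintro ⟨z, t⟩ ⟨hz, ht⟩
      rw [mem_closedBall_zero_iff] at hz
      rw [mem_gaugeBall_zero_iff]
      refine lt_of_pow_lt_pow_left₀ 4 zero_le_one ?_
      rw [grushinGauge_pow_four]
      have h1 : ‖z‖ ^ 4 ≤ (1 / 8) ^ 4 := by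
        gcongr
        exact hz.trans hδ8
      have h2 : t ^ 2 ≤ (1 / 8) ^ 2 := sq_le_sq' ht.1 ht.2
      simp only
      linarith
    exact setIntegral_mono_set (hu.integrableOn_sq.mono_set hbox1)
      (ae_of_all _ fun p => sq_nonneg _) hbox.eventuallyLE
  · rw [← integral_const_mul]
    have hsub : B \ S ⊆ B := Set.sdiff_subset
    calc ∫ p in B \ S, u p ^ 2
        ≤ ∫ p in B \ S, r ^ 2 / δ ^ 2 * (u p ^ 2 * grushinWeight p) :=
          setIntegral_mono_on (hui.mono_set hsub) ((hwi.mono_set hsub).const_mul _)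
            (hBm.diff hSm) fun p hp => sq_le_mul_grushinWeight hδ hp.1 (not_le.1 hp.2) _
      _ ≤ _ := setIntegral_mono_set (hwi.const_mul _)
          (ae_of_all _ fun p => mul_nonneg (by positivity)
            (mul_nonneg (sq_nonneg _) (grushinWeight_nonneg p))) hsub.eventuallyLE

end Grushin

/-! ### Equivalence of the two notions of vanishing -/

theorem mainTheorem6 (N : ℕ) (hN : 1 ≤ N) (u : GrushinSpace N → ℝ)
    (hu : MemM22 (gaugeBall N 0 1) u) :
    VanishesInfiniteOrderMean 2 0 u ↔ VanishesInfiniteOrderWeighted u := by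
  have hW0 : ∀ r, 0 ≤ ∫ p in gaugeBall N 0 r, u p ^ 2 * grushinWeight p := fun r =>
    integral_nonneg fun p => mul_nonneg (sq_nonneg _) (grushinWeight_nonneg p)
  have hM0 : ∀ r, 0 ≤ ∫ p in gaugeBall N 0 r, u p ^ 2 := fun r =>
    integral_nonneg fun p => sq_nonneg _
  have hsmall : ∀ {c : ℝ}, 0 < c → ∀ᶠ r : ℝ in 𝓝[>] 0, 0 < r ∧ r ≤ c := fun {c} hc =>
    Filter.mem_of_superset (Ioc_mem_nhdsGT hc) fun r hr => hr
  simp only [VanishesInfiniteOrderMean, VanishesInfiniteOrderWeighted, Real.rpow_two, sq_abs]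
  constructor
  · rintro ⟨-, h⟩
    refine ⟨⟨1, one_pos, hu.integrableOn_sq_mul_grushinWeight⟩, fun l hl => ?_⟩
    refine IsBigO.trans (IsBigO.of_bound 1 ?_) (h l hl)
    filter_upwards [hsmall one_pos] with r hr
    have hsub := gaugeBall_zero_mono (N := N) hr.2
    rw [Real.norm_of_nonneg (hW0 r), Real.norm_of_nonneg (hM0 r), one_mul]
    exact integral_mono (hu.integrableOn_sq_mul_grushinWeight.mono_set hsub)
      (hu.integrableOn_sq.mono_set hsub) fun p =>
        mul_le_of_le_one_right (sq_nonneg _) (grushinWeight_le_one p)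
  · rintro ⟨-, h⟩
    refine ⟨⟨1, one_pos, hu.integrableOn_sq⟩, fun l hl => ?_⟩
    obtain ⟨A, hA⟩ := setIntegral_sq_degenerate_box_le hN hu
    obtain ⟨C, hC⟩ := (h (3 * l) (by positivity)).bound
    have hlim : Tendsto (fun r : ℝ => r ^ l) (𝓝[>] 0) (𝓝 0) := by
      have := (Real.continuousAt_rpow_const 0 l (Or.inr hl.le)).tendsto
      rw [Real.zero_rpow hl.ne'] at this
      exact this.mono_left nhdsWithin_le_nhds
    have hev := hlim.eventually_le_const (show (0 : ℝ) < 1 / 8 by norm_num)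
    -- With `δ = r ^ l` the far part is at most `(r² / δ²) C δ³ = C r² δ`, and `r² ≤ 1`.
    refine IsBigO.of_bound (A + |C|) ?_
    filter_upwards [hC, hev, hsmall (show (0 : ℝ) < 1 / 4 by norm_num)] with r hCr hr8 hr
    have hδ : 0 < r ^ l := Real.rpow_pos_of_pos hr.1 l
    have h3 : r ^ (3 * l) = (r ^ l) ^ 3 := by
      rw [mul_comm, Real.rpow_mul hr.1.le]; norm_cast
    rw [Real.norm_of_nonneg (hW0 r), Real.norm_of_nonneg (Real.rpow_nonneg hr.1.le _), h3] at hCr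
    rw [Real.norm_of_nonneg (hM0 r), Real.norm_of_nonneg hδ.le]
    refine (setIntegral_sq_gaugeBall_le hu hr.1 hr.2 hδ hr8).trans ?_
    have hr1 : r ^ 2 ≤ 1 := pow_le_one₀ hr.1.le (by linarith [hr.2])
    calc _ ≤ A * r ^ l + r ^ 2 / (r ^ l) ^ 2 * (|C| * (r ^ l) ^ 3) := by
          gcongr
          · exact hA _ hδ hr8
          · exact hCr.trans (by gcongr; exact le_abs_self C)
      _ = A * r ^ l + r ^ 2 * (|C| * r ^ l) := by field_simp
      _ ≤ A * r ^ l + 1 * (|C| * r ^ l) := by gcongr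
      _ = (A + |C|) * r ^ l := by ring
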